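/- Call a function $f:\Sigma_0^*\times\cdots\times\Sigma_{n-1}^*\to\Sigma_n^*$, where $\Sigma_0,\dots,\Sigma_n$ are finite alphabets, \emph{regular} if there is a finite (nondeterministic) automaton over the alphabet $(\Sigma_0\cup\{\#\})\times\cdots\times(\Sigma_n\cup\{\#\})$, with $\#$ a fresh padding character, such that for all words $w_i\in\Sigma_i^*$ $(0\le i\le n)$ one has $f(w_0,\dots,w_{n-1})=w_n$ if and only if the automaton accepts the word of length $\max_i|w_i|$ whose $k$-th character has as its $j$-th coordinate the $k$-th character of $w_j$ if $k<|w_j|$, and $\#$ otherwise. A set $G$ of functions between words \emph{generates} $f$ under multivariable composition if $f$ can be written as a (type-correct) composition of members of $G$ applied to the input variables of $f$, each variable being usable any number of times. Proposition. Let $G$ be a set of regular functions, of any arities and over any finite alphabets, and let $\Sigma$ be a nonempty finite alphabet. If $G$ generates every regular function $f:(\Sigma^*)^n\to\Sigma^*$ with $n\ge 1$, then $G$ is infinite. In particular, any set of regular functions which generates all regular functions under multivariable composition must be infinite. -/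

import Mathlib

universe u

namespace RegularFunctions

/-- Merge finitely many words in parallel into one word over the product of the padded alphabets.
The dummy character `#` is `none`; the result has length `max_i |w i|`. -/
def tuplefy {m : ℕ} {A : Fin m → Type u} (w : ∀ i, List (A i)) : List (∀ i, Option (A i)) :=
  List.ofFn (n := Finset.univ.sup fun i => (w i).length) fun k i => (w i)[(k : ℕ)]?

/-- A relation between words over the alphabets `A 0, …, A (m - 1)` is regular if some finite
(nondeterministic) automaton accepts the merged word exactly when the relation holds. -/
def IsRegularRel {m : ℕ} (A : Fin m → Type u) (R : (∀ i, List (A i)) → Prop) : Prop :=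
  ∃ (Q : Type) (_ : Finite Q) (M : NFA (∀ i, Option (A i)) Q),
    ∀ w : ∀ i, List (A i), R w ↔ tuplefy w ∈ M.accepts

/-- A (total) `n`-ary function `Σ₀* × ⋯ × Σₙ₋₁* → Σₙ*`, together with its arity `n` and its
alphabets `Σ₀, …, Σₙ`. -/
structure WordFunction where
  arity : ℕ
  alphabet : Fin (arity + 1) → Type u
  toFun : (∀ i : Fin arity, List (alphabet i.castSucc)) → List (alphabet (Fin.last arity))

/-- A function between words over finite alphabets is regular if its graph is a regular relation. -/
def WordFunction.IsRegular (f : WordFunction.{u}) : Prop :=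
  (∀ i, Finite (f.alphabet i)) ∧
    IsRegularRel f.alphabet fun w => f.toFun (fun i => w i.castSucc) = w (Fin.last f.arity)

/-- `Composite G A B f`: the function `f : A 0* × ⋯ × A (n - 1)* → B*` is a multivariable
composition of members of `G`. Every input variable may be used any number of times, in any order,
so that the projections are available without belonging to `G`. -/
inductive Composite (G : Set WordFunction.{u}) {n : ℕ} (A : Fin n → Type u) :
    (B : Type u) → ((∀ i, List (A i)) → List B) → Prop
  | var (i : Fin n) : Composite G A (A i) (fun w => w i)
  | comp (g : WordFunction.{u}) (hg : g ∈ G)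
      (h : ∀ j : Fin g.arity, (∀ i, List (A i)) → List (g.alphabet j.castSucc))
      (hh : ∀ j, Composite G A (g.alphabet j.castSucc) (h j)) :
      Composite G A (g.alphabet (Fin.last g.arity)) (fun w => g.toFun fun j => h j w)

/-- `G` generates the function `f` under multivariable composition. -/
def Generates (G : Set WordFunction.{u}) (f : WordFunction.{u}) : Prop :=
  Composite G (fun i : Fin f.arity => f.alphabet i.castSucc) (f.alphabet (Fin.last f.arity)) f.toFun

end RegularFunctions

namespace RegularFunctions

/-! A regular function can only introduce periods composed of small primes. Feed it a family of
inputs that is uniform with period `m` (`IsUniform`). By pigeonhole, a deterministic automaton with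
`c` states for its graph loops within any window of length `m * c`. Pumping the loop yields an
accepted tuple with the inputs for a larger index, and since the graph is functional its last word
is the true output. So the outputs are uniform with period `m * c!` (`Recognizes.isUniform_last`).

If `G` is finite, some prime `p` exceeds all state counts, so every composite sends the words `a^n`
to a family with period prime to `p`. The regular function `keepMultiples S p` does not. -/

/-- The state sequence of a deterministic automaton reading the infinite sequence `a`. -/
def runState {σ α : Type*} (step : σ → α → σ) (start : σ) (a : ℕ → α) : ℕ → σ
  | 0 => start
  | k + 1 => step (runState step start a k) (a k)

/-- The sequence of padded letters of a tuple of words. -/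
def letters {m : ℕ} {A : Fin m → Type u} (w : ∀ i, List (A i)) (k : ℕ) : ∀ i, Option (A i) :=
  fun i => (w i)[k]?

/-- The automaton `(step, start, acc)`, which reads words followed by any amount of padding,
recognizes the relation `R`. -/
def Recognizes {m : ℕ} {A : Fin m → Type u} {σ : Type} (step : σ → (∀ i, Option (A i)) → σ)
    (start : σ) (acc : Set σ) (R : (∀ i, List (A i)) → Prop) : Prop :=
  ∀ (w : ∀ i, List (A i)) (L : ℕ), (∀ i, (w i).length ≤ L) →
    (R w ↔ runState step start (letters w) L ∈ acc)

theorem DFA_eval_ofFn {α σ : Type*} (D : DFA α σ) (a : ℕ → α) (k : ℕ) :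
    D.eval (List.ofFn fun i : Fin k => a i) = runState D.step D.start a k := by
  induction k with
  | zero => simp [runState]
  | succ k ih =>
    rw [List.ofFn_succ_last, DFA.eval_append_singleton]
    simp only [Fin.val_castSucc, Fin.val_last, runState]
    rw [ih]

theorem runState_congr {σ α : Type*} {step step' : σ → α → σ} {start : σ} {a b : ℕ → α} {L : ℕ}
    (h : ∀ q, ∀ k < L, step q (a k) = step' q (b k)) :
    ∀ k ≤ L, runState step start a k = runState step' start b k := by
  intro k hk
  induction k with
  | zero => rfl
  | succ k ih => simp only [runState]; rw [ih (by omega), h _ _ (by omega)]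

theorem runState_add {σ α : Type*} {step : σ → α → σ} {start : σ} {a b : ℕ → α} {s l : ℕ}
    (h0 : runState step start a (s + l) = runState step start b s)
    (h : ∀ k, s ≤ k → a (k + l) = b k) :
    ∀ k, s ≤ k → runState step start a (k + l) = runState step start b k := by
  intro k hk
  induction k, hk using Nat.le_induction with
  | base => exact h0
  | succ k hk ih =>
    rw [show k + 1 + l = (k + l) + 1 by omega]
    simp only [runState]
    rw [ih, h k hk]

/-- Freezing the determinized automaton on the all-padding letter makes acceptance independent of
the amount of trailing padding. -/
theorem IsRegularRel.exists_recognizes {m : ℕ} {A : Fin m → Type u}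
    {R : (∀ i, List (A i)) → Prop} (hR : IsRegularRel A R) :
    ∃ (σ : Type) (_ : Finite σ) (step : σ → (∀ i, Option (A i)) → σ) (start : σ) (acc : Set σ),
      Recognizes step start acc R := by
  classical
  obtain ⟨Q, hQ, M, hM⟩ := hR
  refine ⟨Set Q, inferInstance,
    fun q a => if a = fun _ => none then q else M.toDFA.step q a, M.toDFA.start,
    M.toDFA.accept, ?_⟩
  intro w L hL
  rw [hM w, ← NFA.toDFA_correct]
  set L₀ := Finset.univ.sup fun i => (w i).length with hL₀
  have hle : L₀ ≤ L := Finset.sup_le fun i _ => hL i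
  have hlen : ∀ i, (w i).length ≤ L₀ := fun i =>
    Finset.le_sup (f := fun i => (w i).length) (Finset.mem_univ i)
  change M.toDFA.eval (tuplefy w) ∈ M.toDFA.accept ↔ _
  have h1 : tuplefy w = List.ofFn fun i : Fin L₀ => letters w i := rfl
  rw [h1, DFA_eval_ofFn]
  rw [← runState_congr (L := L₀) (step := fun q a => if a = fun _ => none then q
    else M.toDFA.step q a) (a := letters w) ?_ L₀ le_rfl]
  · suffices h : ∀ k, L₀ ≤ k → runState (fun q a => if a = fun _ => none then q
        else M.toDFA.step q a) M.toDFA.start (letters w) k =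
        runState (fun q a => if a = fun _ => none then q
        else M.toDFA.step q a) M.toDFA.start (letters w) L₀ by rw [h L hle]
    intro k hk
    induction k, hk using Nat.le_induction with
    | base => rfl
    | succ k hk ih =>
      simp only [runState]
      rw [if_pos, ih]
      funext i
      exact List.getElem?_eq_none ((hlen i).trans hk)
  · intro q k hk
    obtain ⟨i, -, hi⟩ := (Finset.lt_sup_iff).1 hk
    refine if_neg fun h => ?_
    have := congrFun h i
    simp only [letters, List.getElem?_eq_none_iff] at this
    omega

/-- The words `x n` are, for large `n`, invariant under shifting both `n` and the positions away
from the start by `m`, and under shifting `n` alone for positions well below `n`. -/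
def IsUniform {B : Type u} (N m : ℕ) (x : ℕ → List B) : Prop :=
  (∀ n k, N ≤ n → N ≤ k → (x (n + m))[k + m]? = (x n)[k]?) ∧
    ∀ n k, k + N ≤ n → (x (n + m))[k]? = (x n)[k]?

theorem IsUniform.mul {B : Type u} {N N' m : ℕ} {x : ℕ → List B} (h : IsUniform N m x)
    (hN : N ≤ N') (c : ℕ) : IsUniform N' (m * c) x := by
  induction c with
  | zero => exact ⟨fun _ _ _ _ => rfl, fun _ _ _ => rfl⟩
  | succ c ih =>
    refine ⟨fun n k hn hk => ?_, fun n k hk => ?_⟩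
    · rw [Nat.mul_succ, ← add_assoc, ← add_assoc, h.1 _ _ (by omega) (by omega), ih.1 _ _ hn hk]
    · rw [Nat.mul_succ, ← add_assoc, h.2 _ _ (by omega), ih.2 _ _ hk]

/-! ### Pumping along uniform families -/

section Pumping

variable {r : ℕ} {A : Fin (r + 1) → Type u} {R : (∀ i, List (A i)) → Prop} {σ : Type}
  {step : σ → (∀ i, Option (A i)) → σ} {start : σ} {acc : Set σ}
  {w : ℕ → ∀ i, List (A i)}

/-- Uniformity says that passing from `n` to `n + l` repeats the block `[b, b + l)` of each input.
Repeating it in the output too gives an accepted tuple, because the block is a loop, and `hfun`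
identifies this tuple with `w (n + l)`. By `hlen` the output does not end inside the block, where
repetition would put padding before letters. -/
theorem pump_once (hrec : Recognizes step start acc R)
    (hfun : ∀ v v', R v → R v' → (∀ i : Fin r, v i.castSucc = v' i.castSucc) → v = v')
    (hw : ∀ n, R (w n)) {N b l n : ℕ}
    (hu : ∀ i : Fin r, IsUniform N l fun n => w n i.castSucc)
    (hl : 0 < l) (hb : N ≤ b) (hn : b + l + N ≤ n)
    (hloop : runState step start (letters (w n)) (b + l) = runState step start (letters (w n)) b)
    (hlen : (w n (Fin.last r)).length ≤ b ∨ b + l ≤ (w n (Fin.last r)).length) :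
    (∀ k, k < b + l → letters (w (n + l)) k = letters (w n) k) ∧
      ∀ k, b ≤ k → letters (w (n + l)) (k + l) = letters (w n) k := by
  let z : List (A (Fin.last r)) :=
    (w n (Fin.last r)).take (b + l) ++ (w n (Fin.last r)).drop b
  let v : ∀ i, List (A i) := Fin.snoc (fun i => w (n + l) i.castSucc) z
  have hv : ∀ i : Fin r, v i.castSucc = w (n + l) i.castSucc := fun i => by simp [v]
  have hvl : v (Fin.last r) = z := by simp [v]
  have h1 : ∀ k, k < b + l → letters v k = letters (w n) k := by
    intro k hk
    funext i
    refine Fin.lastCases ?_ (fun i => ?_) i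
    · simp only [letters, hvl, z]
      rw [List.getElem?_append]
      simp only [List.length_take, List.getElem?_take, List.getElem?_drop]
      split_ifs with h
      · rfl
      · rw [List.getElem?_eq_none (by omega), List.getElem?_eq_none (by omega)]
    · simp only [letters, hv]
      exact (hu i).2 n k (by omega)
  have h2 : ∀ k, b ≤ k → letters v (k + l) = letters (w n) k := by
    intro k hk
    funext i
    refine Fin.lastCases ?_ (fun i => ?_) i
    · simp only [letters, hvl, z]
      rw [List.getElem?_append]
      simp only [List.length_take, List.getElem?_take, List.getElem?_drop]
      split_ifs with h h'
      · omega
      · omega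
      · rcases hlen with hlen | hlen
        · rw [List.getElem?_eq_none (by omega), List.getElem?_eq_none (by omega)]
        · congr 1
          omega
    · simp only [letters, hv]
      exact (hu i).1 n k (by omega) (by omega)
  have hRv : R v := by
    let L := b + (Finset.univ.sup fun i => (w n i).length) +
      Finset.univ.sup fun i => (v i).length
    have hL1 : ∀ i, (w n i).length ≤ L := fun i =>
      (Finset.le_sup (f := fun i => (w n i).length) (Finset.mem_univ i)).trans (by omega)
    have hL2 : ∀ i, (v i).length ≤ L + l := fun i =>
      (Finset.le_sup (f := fun i => (v i).length) (Finset.mem_univ i)).trans (by omega)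
    rw [hrec v _ hL2, runState_add (b := letters (w n)) (s := b) ?_ h2 L (by omega),
      ← hrec (w n) L hL1]
    · exact hw n
    · rw [runState_congr (b := letters (w n)) (step' := step) (L := b + l)
        (fun q k hk => by rw [h1 k hk]) _ le_rfl, hloop]
  have := hfun v (w (n + l)) hRv (hw _) hv
  rw [← this]
  exact ⟨h1, h2⟩

theorem pump (hrec : Recognizes step start acc R)
    (hfun : ∀ v v', R v → R v' → (∀ i : Fin r, v i.castSucc = v' i.castSucc) → v = v')
    (hw : ∀ n, R (w n)) {N b l n : ℕ}
    (hu : ∀ i : Fin r, IsUniform N l fun n => w n i.castSucc)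
    (hl : 0 < l) (hb : N ≤ b) (hn : b + l + N ≤ n)
    (hloop : runState step start (letters (w n)) (b + l) = runState step start (letters (w n)) b)
    (hlen : (w n (Fin.last r)).length ≤ b ∨ b + l ≤ (w n (Fin.last r)).length) (j : ℕ) :
    (∀ k, k < b + l → letters (w (n + l * j)) k = letters (w n) k) ∧
      ∀ k, b ≤ k → letters (w (n + l * j)) (k + l * j) = letters (w n) k := by
  induction j with
  | zero => exact ⟨fun _ _ => rfl, fun _ _ => rfl⟩
  | succ j ih =>
    have hrun := runState_congr (a := letters (w (n + l * j))) (b := letters (w n)) (step := step)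
      (step' := step) (start := start) (L := b + l) (fun q k hk => by rw [ih.1 k hk])
    have key := pump_once (n := n + l * j) hrec hfun hw hu hl hb (by omega)
      (by rw [hrun _ le_rfl, hrun b (by omega), hloop]) ?_
    · refine ⟨fun k hk => ?_, fun k hk => ?_⟩
      · rw [Nat.mul_succ, ← add_assoc, key.1 k hk, ih.1 k hk]
      · rw [Nat.mul_succ, ← add_assoc, ← add_assoc, key.2 _ (by omega), ih.2 k hk]
    · refine hlen.imp (fun h => ?_) fun h => ?_
      · have := congrFun (ih.1 b (by omega)) (Fin.last r)
        simp only [letters] at this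
        rwa [List.getElem?_eq_none h, List.getElem?_eq_none_iff] at this
      · have := congrFun (ih.1 (b + l - 1) (by omega)) (Fin.last r)
        simp only [letters] at this
        by_contra hlt
        rw [List.getElem?_eq_none (by omega), eq_comm, List.getElem?_eq_none_iff] at this
        omega

theorem pump_window [Finite σ] (hrec : Recognizes step start acc R)
    (hfun : ∀ v v', R v → R v' → (∀ i : Fin r, v i.castSucc = v' i.castSucc) → v = v')
    (hw : ∀ n, R (w n)) {N m s n : ℕ}
    (hu : ∀ i : Fin r, IsUniform N m fun n => w n i.castSucc)
    (hm : 0 < m) (hs : N ≤ s) (hn : s + m * Nat.card σ + N ≤ n)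
    (hlen : (w n (Fin.last r)).length ≤ s ∨
      s + m * Nat.card σ ≤ (w n (Fin.last r)).length) :
    (∀ k, k < s → letters (w (n + m * (Nat.card σ).factorial)) k = letters (w n) k) ∧
      ∀ k, s + m * Nat.card σ ≤ k →
        letters (w (n + m * (Nat.card σ).factorial)) (k + m * (Nat.card σ).factorial) =
          letters (w n) k := by
  -- Pigeonhole on positions spaced by `m`, so that the loop length is a multiple of the period of
  -- the inputs.
  obtain ⟨i, j, hij, hjc, heq⟩ : ∃ i j, i < j ∧ j ≤ Nat.card σ ∧
      runState step start (letters (w n)) (s + m * j) =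
        runState step start (letters (w n)) (s + m * i) := by
    have := Fintype.ofFinite σ
    obtain ⟨i, j, hne, heq⟩ := Fintype.exists_ne_map_eq_of_card_lt
      (fun i : Fin (Nat.card σ + 1) => runState step start (letters (w n)) (s + m * i))
      (by simp [Nat.card_eq_fintype_card])
    rcases lt_or_gt_of_ne hne with h | h
    · exact ⟨i, j, h, by omega, heq.symm⟩
    · exact ⟨j, i, h, by omega, heq⟩
  obtain ⟨d, rfl⟩ := Nat.exists_eq_add_of_lt hij
  -- Pumping `q` times makes the total shift independent of the loop found.
  obtain ⟨q, hq⟩ : d + 1 ∣ (Nat.card σ).factorial :=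
    Nat.dvd_factorial (Nat.succ_pos d) (by omega)
  have hmul : m * i + m * (d + 1) ≤ m * Nat.card σ := by
    rw [← Nat.mul_add]
    exact Nat.mul_le_mul_left m (by omega)
  have hsplit : s + m * (i + d + 1) = s + m * i + m * (d + 1) := by ring
  rw [hsplit] at heq
  have key := pump (l := m * (d + 1)) (b := s + m * i) hrec hfun hw
    (fun i => (hu i).mul le_rfl (d + 1)) (Nat.mul_pos hm (Nat.succ_pos d)) (by omega)
    (by omega) heq (hlen.imp (by omega) (by omega)) q
  rw [mul_assoc, ← hq] at key
  exact ⟨fun k hk => key.1 k (by omega), fun k hk => key.2 k (by omega)⟩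

/-- The output may end inside a window, which blocks pumping there; of two adjacent windows, at
least one is free of this. They lie near the start for the first clause and near position `n` for
the second. -/
theorem Recognizes.isUniform_last [Finite σ] (hrec : Recognizes step start acc R)
    (hfun : ∀ v v', R v → R v' → (∀ i : Fin r, v i.castSucc = v' i.castSucc) → v = v')
    (hw : ∀ n, R (w n)) {N m : ℕ}
    (hu : ∀ i : Fin r, IsUniform N m fun n => w n i.castSucc) (hm : 0 < m) :
    IsUniform (2 * N + 2 * (m * Nat.card σ) + 1) (m * (Nat.card σ).factorial)
      fun n => w n (Fin.last r) := by
  refine ⟨fun n k hn hk => ?_, fun n k hk => ?_⟩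
  · by_cases h : (w n (Fin.last r)).length ≤ N ∨ N + m * Nat.card σ ≤ (w n (Fin.last r)).length
    · exact congrFun ((pump_window hrec hfun hw hu hm le_rfl (by omega) h).2 k (by omega)) _
    · exact congrFun ((pump_window (s := N + m * Nat.card σ) hrec hfun hw hu hm (by omega)
        (by omega) (by omega)).2 k (by omega)) _
  · by_cases h : (w n (Fin.last r)).length ≤ n - N - m * Nat.card σ ∨
        n - N - m * Nat.card σ + m * Nat.card σ ≤ (w n (Fin.last r)).length
    · exact congrFun ((pump_window hrec hfun hw hu hm (by omega) (by omega) h).1 k (by omega)) _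
    · exact congrFun ((pump_window (s := n - N - 2 * (m * Nat.card σ)) hrec hfun hw hu hm
        (by omega) (by omega) (by omega)).1 k (by omega)) _

end Pumping

/-! ### Periods prime to `p` under composition -/

/-- The words `x n` are uniform for some period prime to `p`. -/
def IsUniformAwayFrom (p : ℕ) {B : Type u} (x : ℕ → List B) : Prop :=
  ∃ N m, 0 < m ∧ ¬ p ∣ m ∧ IsUniform N m x

/-- Applying `g` preserves uniformity for periods prime to `p`. -/
def WordFunction.PreservesUniformity (p : ℕ) (g : WordFunction.{u}) : Prop :=
  ∀ y : ∀ j : Fin g.arity, ℕ → List (g.alphabet j.castSucc),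
    (∀ j, IsUniformAwayFrom p (y j)) → IsUniformAwayFrom p fun n => g.toFun fun j => y j n

theorem WordFunction.IsRegular.preservesUniformity {g : WordFunction.{u}} (hg : g.IsRegular) :
    ∃ K : ℕ, ∀ p, p.Prime → K < p → g.PreservesUniformity p := by
  obtain ⟨σ, hσ, step, start, acc, hrec⟩ := hg.2.exists_recognizes
  refine ⟨Nat.card σ, fun p hp hK y hy => ?_⟩
  choose N m hm hpm hu using hy
  have hu' : ∀ j, IsUniform (∑ j, N j) (∏ j, m j) (y j) := fun j => by
    obtain ⟨c, hc⟩ := Finset.dvd_prod_of_mem m (Finset.mem_univ j)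
    rw [hc]
    exact (hu j).mul (Finset.single_le_sum (fun _ _ => Nat.zero_le _) (Finset.mem_univ j)) c
  have hpos : 0 < ∏ j, m j := Finset.prod_pos fun j _ => hm j
  let w : ℕ → ∀ i, List (g.alphabet i) := fun n =>
    Fin.snoc (fun j => y j n) (g.toFun fun j => y j n)
  have hwj : ∀ n (j : Fin g.arity), w n j.castSucc = y j n := fun n j => by simp [w]
  have hwl : ∀ n, w n (Fin.last _) = g.toFun fun j => y j n := fun n => by simp [w]
  have key := hrec.isUniform_last (w := w) (N := ∑ j, N j) (m := ∏ j, m j) ?_ ?_ ?_ hpos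
  · refine ⟨_, _, Nat.mul_pos hpos (Nat.factorial_pos _), ?_, by simpa only [hwl] using key⟩
    -- The new period is the product of the input periods times the factorial of the state count,
    -- which is below `p`.
    rw [hp.dvd_mul, hp.dvd_factorial, hp.prime.dvd_finsetProd_iff]
    rintro (⟨j, -, hj⟩ | h)
    · exact hpm j hj
    · omega
  · intro v v' hv hv' h
    funext i
    refine Fin.lastCases ?_ h i
    rw [← hv, ← hv']
    simp only [h]
  · intro n
    simp only [hwj, hwl]
  · intro j
    simpa only [hwj] using hu' j

theorem Composite.isUniformAwayFrom {G : Set WordFunction.{u}} {p : ℕ}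
    (hG : ∀ g ∈ G, g.PreservesUniformity p) {n : ℕ} {A : Fin n → Type u}
    {x : ℕ → ∀ i, List (A i)} (hx : ∀ i, IsUniformAwayFrom p fun n => x n i)
    {B : Type u} {f : (∀ i, List (A i)) → List B} (hf : Composite G A B f) :
    IsUniformAwayFrom p fun n => f (x n) := by
  induction hf with
  | var i => exact hx i
  | comp g hg h hh ih => exact hG g hg (fun j n => h j (x n)) ih

/-! ### A regular function with period `p` -/

/-- The unary function that keeps the words of length divisible by `p` and erases the others. -/
def keepMultiples (S : Type u) (p : ℕ) : WordFunction.{u} where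
  arity := 1
  alphabet _ := S
  toFun w := if p ∣ (w 0).length then w 0 else []

/-- The automaton that counts letters modulo `p` and remembers whether the two words agree and
whether the second one is empty. -/
def keepMultiplesDFA (S : Type u) (p : ℕ) : DFA (Fin 2 → Option S) (ZMod p × Prop × Prop) where
  step q a := (q.1 + 1, q.2.1 ∧ a 0 = a 1, q.2.2 ∧ a 1 = none)
  start := (0, True, True)
  accept := {q | (q.1 = 0 → q.2.1) ∧ (q.1 ≠ 0 → q.2.2)}

theorem keepMultiplesDFA_eval (S : Type u) (p : ℕ) (l : List (Fin 2 → Option S)) :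
    (keepMultiplesDFA S p).eval l =
      ((l.length : ZMod p), (∀ a ∈ l, a 0 = a 1), ∀ a ∈ l, a 1 = none) := by
  induction l using List.reverseRecOn with
  | nil => simp [keepMultiplesDFA]
  | append_singleton l a ih =>
    rw [DFA.eval_append_singleton, ih]
    simp [keepMultiplesDFA, or_imp, forall_and]

theorem isRegularRel_keepMultiples (S : Type u) (p : ℕ) [NeZero p] :
    IsRegularRel (fun _ : Fin 2 => S)
      fun w => (if p ∣ (w 0).length then w 0 else []) = w 1 := by
  refine ⟨ZMod p × Prop × Prop, inferInstance, (keepMultiplesDFA S p).toNFA, fun w => ?_⟩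
  rw [DFA.toNFA_correct]
  change _ ↔ (keepMultiplesDFA S p).eval _ ∈ (keepMultiplesDFA S p).accept
  rw [keepMultiplesDFA_eval]
  have hlen : (tuplefy w).length = max (w 0).length (w 1).length := by
    simp [tuplefy, Fin.univ_succ]
  have hmem : ∀ P : (Fin 2 → Option S) → Prop, (∀ a ∈ tuplefy w, P a) ↔
      ∀ k < max (w 0).length (w 1).length, P fun i => (w i)[k]? := by
    intro P
    rw [← hlen]
    simp only [tuplefy, List.forall_mem_ofFn_iff, List.length_ofFn, Fin.forall_iff]
  have heq : (∀ a ∈ tuplefy w, a 0 = a 1) ↔ w 0 = w 1 := by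
    rw [hmem]
    refine ⟨fun h => List.ext_getElem? fun k => ?_, fun h k _ => congrArg (·[k]?) h⟩
    by_cases hk : k < max (w 0).length (w 1).length
    · exact h k hk
    · rw [List.getElem?_eq_none (by omega), List.getElem?_eq_none (by omega)]
  have hnil : (∀ a ∈ tuplefy w, a 1 = none) ↔ w 1 = [] := by
    rw [hmem]
    refine ⟨fun h => ?_, fun h k _ => congrArg (·[k]?) h⟩
    by_contra hne
    have hpos := List.length_pos_of_ne_nil hne
    have := h 0 (by omega)
    rw [List.getElem?_eq_none_iff] at this
    omega
  -- The counter sees the maximum of the two lengths, which equals the length of `w 0` whenever the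
  -- words agree or `w 1` is empty.
  simp only [keepMultiplesDFA, Set.mem_ofPred_eq, ne_eq, heq, hnil, hlen, ZMod.natCast_eq_zero_iff]
  constructor
  · intro h
    split_ifs at h with hp
    · exact ⟨fun _ => h, fun hn => absurd (by rwa [← h, max_self]) hn⟩
    · exact ⟨fun hn => absurd (by simpa [← h] using hn) hp, fun _ => h.symm⟩
  · rintro ⟨h1, h2⟩
    by_cases hp : p ∣ max (w 0).length (w 1).length
    · have := h1 hp
      rw [this, max_self] at hp
      rw [this, if_pos hp]
    · have h := h2 hp
      rw [h] at hp
      simp only [List.length_nil, Nat.max_zero] at hp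
      rw [if_neg hp, h]

theorem keepMultiples_isRegular (S : Type u) [Finite S] (p : ℕ) [NeZero p] :
    (keepMultiples S p).IsRegular :=
  ⟨fun _ => ‹Finite S›, isRegularRel_keepMultiples S p⟩

theorem isUniform_replicate {B : Type u} (a : B) : IsUniform 1 1 fun n => List.replicate n a := by
  refine ⟨fun n k _ _ => ?_, fun n k hk => ?_⟩
  · simp [List.getElem?_replicate]
  · simp only [List.getElem?_replicate]
    rw [if_pos (by omega), if_pos (by omega)]

end RegularFunctions

theorem mainTheorem11 (S : Type u) [Finite S] [Nonempty S]
    (G : Set RegularFunctions.WordFunction.{u}) (hreg : ∀ g ∈ G, g.IsRegular)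
    (hgen : ∀ f : RegularFunctions.WordFunction.{u},
      f.IsRegular → 0 < f.arity → (∀ i, f.alphabet i = S) → RegularFunctions.Generates G f) :
    G.Infinite := by
  intro hfin
  have hK : ∀ g : G, ∃ K : ℕ, ∀ p, p.Prime → K < p → g.1.PreservesUniformity p :=
    fun g => (hreg g.1 g.2).preservesUniformity
  choose K hK using hK
  have := hfin.to_subtype
  obtain ⟨M, hM⟩ := (Set.finite_range K).bddAbove
  obtain ⟨p, hMp, hp⟩ := Nat.exists_infinite_primes (M + 1)
  have : NeZero p := ⟨hp.ne_zero⟩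
  have hG : ∀ g ∈ G, g.PreservesUniformity p := fun g hg =>
    hK ⟨g, hg⟩ p hp (lt_of_le_of_lt (hM ⟨⟨g, hg⟩, rfl⟩) hMp)
  obtain ⟨a⟩ := ‹Nonempty S›
  have hgen' := hgen _ (RegularFunctions.keepMultiples_isRegular S p) Nat.one_pos fun _ => rfl
  obtain ⟨N, m, hm, hpm, hu⟩ := RegularFunctions.Composite.isUniformAwayFrom hG
    (x := fun n _ => List.replicate n a)
    (fun _ => ⟨1, 1, one_pos, hp.one_lt.ne' ∘ Nat.dvd_one.1,
      RegularFunctions.isUniform_replicate a⟩) hgen'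
  -- Compare first letters at a large multiple of `p` and `m` steps later: only the first index is
  -- divisible by `p`, so one letter is `a` and the other is missing.
  have h : (if p ∣ (List.replicate (p * (N + 1) + m) a).length then
      List.replicate (p * (N + 1) + m) a else [])[0]? =
    (if p ∣ (List.replicate (p * (N + 1)) a).length then
      List.replicate (p * (N + 1)) a else [])[0]? :=
    hu.2 (p * (N + 1)) 0 (by nlinarith [hp.pos])
  have hpos : 0 < p * (N + 1) := Nat.mul_pos hp.pos (Nat.succ_pos N)
  have hnd : ¬ p ∣ p * (N + 1) + m := fun h => hpm ((Nat.dvd_add_right (dvd_mul_right _ _)).1 h)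
  rw [List.length_replicate, List.length_replicate, if_neg hnd, if_pos (dvd_mul_right _ _),
    List.getElem?_replicate, if_pos hpos] at h
  simp at h
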